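/- Let $n\ge 3$, let $\omega\in\mathbb{C}$ be a primitive $n$-th root of unity, and let the dihedral group $D_n=\langle g,h\mid g^n=h^2=1,\ hgh=g^{-1}\rangle$ act on $M_2(\mathbb{C})$ by algebra automorphisms, $g$ acting as conjugation by $e_{11}+\omega e_{22}$ and $h$ as conjugation by $e_{12}+e_{21}$. Let $X=\{x_1,x_2,\dots\}$ be a countably infinite set, let $\mathbb{C}\langle X;D_n\rangle$ be the free associative unital algebra on the symbols $x^k$ ($x\in X$, $k\in D_n$), with $D_n$ acting by $l\cdot x^{k}=x^{lk}$, and let $L\langle X;D_n\rangle$ be the Lie subalgebra (for the commutator) generated by the symbols $x^k$. For $u=\sum_k c_k k\in\mathbb{C}D_n$ write $u(x)=\sum_k c_k x^k$; identify $x$ with $x^1$. A polynomial $f\in\mathbb{C}\langle X;D_n\rangle$ is a weak $D_n$-identity of the pair $(M_2(\mathbb{C}),sl_2(\mathbb{C}))$ if it vanishes under every substitution of the variables $x\in X$ by traceless matrices (where $x^k$ is replaced by the image under $k$ of the matrix substituted for $x$). A weak $D_n$-ideal is a two-sided ideal of $\mathbb{C}\langle X;D_n\rangle$ that is invariant under all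 algebra endomorphisms of $\mathbb{C}\langle X;D_n\rangle$ that commute with the action of $D_n$ and map $L\langle X;D_n\rangle$ into itself. For $j\in\mathbb{Z}$ put $e_j=\frac1n\sum_{k=0}^{n-1}\omega^{-jk}g^k\in\mathbb{C}D_n$. Then the following polynomials (a relation $p=q$ stands for $p-q$, and $\alpha$ ranges over $\pm1$) form a basis of the weak $D_n$-identities of $(M_2(\mathbb{C}),sl_2(\mathbb{C}))$, that is, the set of all weak $D_n$-identities of this pair is the least weak $D_n$-ideal containing them: 1. $(1+h)e_0(x_1)=0$; 2. $e_0(x_1)f(x_2)+f(x_2)e_0(x_1)=0$, where $f\in\{e_\alpha,he_\alpha\}$; 3. $e_0(x_1)+e_1(x_1)+e_{-1}(x_1)=x_1$; 4. $e_0(x_1)e_0(x_2)-e_0(x_2)e_0(x_1)=0$; 5. $f(x_1)f(x_2)=0$, where $f\in\{e_\alpha,he_\alpha\}$; 6. $f(x_1)f'(x_2)=0$, where $(f,f')\in\{(e_\alpha,he_{-\alpha}),(he_\alpha,e_{-\alpha})\}$; 7. $f(x_1)\,x_2\,f'(x_3)=f(x_3)\,x_2\,f'(x_1)$, where $f,f'\in\{e_\alpha,he_\alpha\}$;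 8. $e_\alpha(x_1)\,x_2\,he_{-\alpha}(x_3)=he_{-\alpha}(x_3)\,x_2\,e_\alpha(x_1)$; 9. $e_\alpha(x_1)\,e_{-\alpha}(x_2)=he_{-\alpha}(x_2)\,he_\alpha(x_1)$; 10. $e_\alpha(x_1)\,he_\alpha(x_2)=e_\alpha(x_2)\,he_\alpha(x_1)$. -/

import Mathlib

/-! ### Weak `G`-identities of associative-Lie `G`-pairs -/

section WeakGIdentities

attribute [local instance] LieRing.ofAssociativeRing

/-- The free associative unital `G`-algebra `F⟨X; G⟩`: the free associative algebra on `X × G`.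
The generator `(x, k)` is the variable `x` with exponent `k`, written `x ^ k`. -/
abbrev FreeGAlgebra (F X G : Type*) [CommRing F] : Type _ := FreeAlgebra F (X × G)

namespace FreeGAlgebra

variable {F X G : Type*} [CommRing F] [Group G]

/-- The action of `k : G` on `F⟨X; G⟩`, sending the generator `x ^ l` to `x ^ (k * l)`. -/
noncomputable def act (k : G) : FreeGAlgebra F X G →ₐ[F] FreeGAlgebra F X G :=
  FreeAlgebra.lift F fun p => FreeAlgebra.ι F (p.1, k * p.2)

variable (F X G) in
/-- The free Lie `G`-algebra `L⟨X; G⟩`, realised as the Lie subalgebra of `F⟨X; G⟩`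
(with the commutator bracket) generated by all the `x ^ k`. -/
noncomputable def lie : LieSubalgebra F (FreeGAlgebra F X G) :=
  LieSubalgebra.lieSpan F (FreeGAlgebra F X G) (Set.range (FreeAlgebra.ι F))

/-- For `u = ∑ c_k k` in the group algebra `F G`, the element `u(x) = ∑ c_k x ^ k`
of `F⟨X; G⟩`. -/
noncomputable def var (u : MonoidAlgebra F G) (x : X) : FreeGAlgebra F X G :=
  u.coeff.sum fun k c => c • FreeAlgebra.ι F (x, k)

/-- Endomorphisms of the `G`-pair `(F⟨X; G⟩, L⟨X; G⟩)`: algebra endomorphisms that commute with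
the action of `G` and map `L⟨X; G⟩` into itself. -/
structure IsPairEndomorphism (ψ : FreeGAlgebra F X G →ₐ[F] FreeGAlgebra F X G) : Prop where
  map_act : ∀ (k : G) (f : FreeGAlgebra F X G), ψ (act k f) = act k (ψ f)
  map_lie : ∀ f ∈ lie F X G, ψ f ∈ lie F X G

/-- Weak `G`-ideals: two-sided ideals of `F⟨X; G⟩` invariant under all endomorphisms of the
`G`-pair `(F⟨X; G⟩, L⟨X; G⟩)`. -/
def IsWeakGIdeal (I : TwoSidedIdeal (FreeGAlgebra F X G)) : Prop :=
  ∀ ψ : FreeGAlgebra F X G →ₐ[F] FreeGAlgebra F X G,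
    IsPairEndomorphism ψ → ∀ f ∈ I, ψ f ∈ I

variable {A : Type*} [Ring A] [Algebra F A]

/-- Evaluation of `G`-polynomials at `x ↦ a x` in an algebra `A` on which `G` acts through `φ`;
the generator `x ^ k` is sent to `φ k (a x)`. -/
noncomputable def eval (φ : G →* (A ≃ₐ[F] A)) (a : X → A) : FreeGAlgebra F X G →ₐ[F] A :=
  FreeAlgebra.lift F fun p => φ p.2 (a p.1)

/-- `f` is a weak `G`-identity of the pair `(A, L)`: it vanishes under every substitution of its
variables by elements of `L`. -/
def IsWeakGIdentity (φ : G →* (A ≃ₐ[F] A)) (L : LieSubalgebra F A)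
    (f : FreeGAlgebra F X G) : Prop :=
  ∀ a : X → A, (∀ x, a x ∈ L) → eval φ a f = 0

variable (X) in
/-- The ideal of all weak `G`-identities of the pair `(A, L)`. -/
noncomputable def weakGIdentities (φ : G →* (A ≃ₐ[F] A)) (L : LieSubalgebra F A) :
    TwoSidedIdeal (FreeGAlgebra F X G) :=
  TwoSidedIdeal.mk' {f | IsWeakGIdentity φ L f}
    (fun a _ => map_zero (eval φ a))
    (fun {f g} hf hg a ha => by
      rw [map_add, hf a ha, hg a ha, add_zero])
    (fun {f} hf a ha => by rw [map_neg, hf a ha, neg_zero])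
    (fun {f g} hg a ha => by rw [map_mul, hg a ha, mul_zero])
    (fun {f g} hf a ha => by rw [map_mul, hf a ha, zero_mul])

/-- `S` is a basis of the weak `G`-identities of `(A, L)`: the ideal of all weak `G`-identities is
the least weak `G`-ideal that contains `S`. -/
def IsBasisOfWeakGIdentities (φ : G →* (A ≃ₐ[F] A)) (L : LieSubalgebra F A)
    (S : Set (FreeGAlgebra F X G)) : Prop :=
  IsLeast {I : TwoSidedIdeal (FreeGAlgebra F X G) | IsWeakGIdeal I ∧ S ⊆ I}
    (weakGIdentities X φ L)

end FreeGAlgebra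

end WeakGIdentities

/-! ### The action of the dihedral group on `M₂(ℂ)` -/

section DihedralAction

/-- Conjugation `x ↦ u x u⁻¹` by the units of an algebra. -/
noncomputable def conjAut (F A : Type*) [CommRing F] [Ring A] [Algebra F A] :
    Aˣ →* (A ≃ₐ[F] A) :=
  (MulSemiringAction.toAlgAut (ConjAct Aˣ) F A).comp ConjAct.toConjAct.toMonoidHom

theorem conjAut_apply {F A : Type*} [CommRing F] [Ring A] [Algebra F A] (u : Aˣ) (x : A) :
    conjAut F A u x = u * x * (u⁻¹ : Aˣ) := rfl

/-- The homomorphism `D_n → H` that sends the rotation `r 1` to `a` and the reflection `sr 0`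
to `b`. -/
noncomputable def dihedralLift {n : ℕ} {H : Type*} [Group H] (a b : H) (ha : a ^ n = 1)
    (hb : b * b = 1) (hab : b * a * b = a⁻¹) : DihedralGroup n →* H :=
  let c : ZMod n →+ Additive H :=
    ZMod.lift n ⟨zmultiplesHom (Additive H) (Additive.ofMul a), by
      simp only [zmultiplesHom_apply, natCast_zsmul, ← ofMul_pow, ha, ofMul_one]⟩
  have hc : ∀ i : ZMod n, b * (c i).toMul * b = (c i).toMul⁻¹ := fun i => by
    obtain ⟨m, rfl⟩ := ZMod.intCast_surjective i
    have hbi : b⁻¹ = b := inv_eq_of_mul_eq_one_right hb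
    have h1 : b * a ^ m * b⁻¹ = (b * a * b⁻¹) ^ m := conj_zpow.symm
    rw [hbi, hab] at h1
    simpa [c] using h1
  MonoidHom.mk'
    (fun
      | .r i => (c i).toMul
      | .sr i => b * (c i).toMul)
    (by
      have hcomm : ∀ i, (c i).toMul * b = b * (c i).toMul⁻¹ := fun i => by
        rw [← hc i, ← mul_assoc, ← mul_assoc, hb, one_mul]
      rintro (i | i) (j | j)
      · simp
      · simp only [DihedralGroup.r_mul_sr, map_sub, toMul_sub, ← mul_assoc, hcomm]
        rw [mul_assoc, ← toMul_neg, ← map_neg, ← toMul_add, ← map_add, ← toMul_sub, ← map_sub,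
          neg_add_eq_sub]
      · simp [mul_assoc]
      · simp only [DihedralGroup.sr_mul_sr, map_sub, toMul_sub]
        rw [mul_assoc, ← mul_assoc _ b, hcomm, mul_assoc, ← mul_assoc b b, hb, one_mul,
          ← toMul_neg, ← map_neg, ← toMul_add, ← map_add, ← toMul_sub, ← map_sub,
          neg_add_eq_sub])

/-- The matrix `e₁₁ + ω e₂₂` as a unit of `M₂(ℂ)`. -/
noncomputable def rotationUnit (ω : ℂ) (hω : ω ≠ 0) : (Matrix (Fin 2) (Fin 2) ℂ)ˣ where
  val := !![1, 0; 0, ω]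
  inv := !![1, 0; 0, ω⁻¹]
  val_inv := by simp [Matrix.one_fin_two, hω]
  inv_val := by simp [Matrix.one_fin_two, hω]

/-- The matrix `e₁₂ + e₂₁` as a unit of `M₂(ℂ)`. -/
noncomputable def reflectionUnit : (Matrix (Fin 2) (Fin 2) ℂ)ˣ where
  val := !![0, 1; 1, 0]
  inv := !![0, 1; 1, 0]
  val_inv := by simp [Matrix.one_fin_two]
  inv_val := by simp [Matrix.one_fin_two]

theorem rotationUnit_pow {n : ℕ} {ω : ℂ} (hω : ω ≠ 0) (h : ω ^ n = 1) :
    rotationUnit ω hω ^ n = 1 := by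
  have key : ∀ m : ℕ, (!![1, 0; 0, ω] : Matrix (Fin 2) (Fin 2) ℂ) ^ m = !![1, 0; 0, ω ^ m] := by
    intro m
    induction m with
    | zero => simp [Matrix.one_fin_two]
    | succ m ih => rw [pow_succ, ih]; simp [pow_succ]
  apply Units.ext
  rw [Units.val_pow_eq_pow_val, Units.val_one, Matrix.one_fin_two]
  exact (key n).trans (by rw [h])

/-- The action of `D_n` on `M₂(ℂ)` in which the rotation `g = r 1` acts as conjugation by
`e₁₁ + ω e₂₂` and the reflection `h = sr 0` as conjugation by `e₁₂ + e₂₁`, for a primitive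
`n`-th root of unity `ω`. -/
noncomputable def dihedralAction {n : ℕ} (hn : 3 ≤ n) {ω : ℂ} (hω : IsPrimitiveRoot ω n) :
    DihedralGroup n →* (Matrix (Fin 2) (Fin 2) ℂ ≃ₐ[ℂ] Matrix (Fin 2) (Fin 2) ℂ) :=
  have h0 : ω ≠ 0 := hω.ne_zero (by omega)
  dihedralLift
    (conjAut ℂ (Matrix (Fin 2) (Fin 2) ℂ) (rotationUnit ω h0))
    (conjAut ℂ (Matrix (Fin 2) (Fin 2) ℂ) reflectionUnit)
    (by rw [← map_pow, rotationUnit_pow h0 hω.pow_eq_one, map_one])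
    (by
      rw [← map_mul, show reflectionUnit * reflectionUnit = 1 from
        Units.ext reflectionUnit.val_inv, map_one])
    (by
      rw [eq_inv_iff_mul_eq_one, ← map_mul, ← map_mul, ← map_mul]
      ext1 x
      rw [conjAut_apply]
      have e : ((reflectionUnit * rotationUnit ω h0 * reflectionUnit * rotationUnit ω h0 :
          (Matrix (Fin 2) (Fin 2) ℂ)ˣ) : Matrix (Fin 2) (Fin 2) ℂ) = ω • 1 := by
        simp [reflectionUnit, rotationUnit, Matrix.one_fin_two]
      have e2 := Units.mul_inv
        (reflectionUnit * rotationUnit ω h0 * reflectionUnit * rotationUnit ω h0)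
      rw [e] at e2 ⊢
      rw [smul_one_mul, smul_mul_assoc, ← mul_smul_comm, ← smul_one_mul ω, e2, mul_one]
      rfl)

theorem dihedralAction_r_one {n : ℕ} (hn : 3 ≤ n) {ω : ℂ} (hω : IsPrimitiveRoot ω n)
    (x : Matrix (Fin 2) (Fin 2) ℂ) :
    dihedralAction hn hω (.r 1) x = !![1, 0; 0, ω] * x * !![1, 0; 0, ω⁻¹] := by
  have h0 : ω ≠ 0 := hω.ne_zero (by omega)
  have h : dihedralAction hn hω (.r 1)
      = conjAut ℂ (Matrix (Fin 2) (Fin 2) ℂ) (rotationUnit ω h0) := by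
    have h1 : (1 : ZMod n) = ((1 : ℤ) : ZMod n) := by simp
    simp only [dihedralAction, dihedralLift, MonoidHom.mk'_apply]
    rw [h1, ZMod.lift_coe]
    simp
  rw [h]
  rfl

theorem dihedralAction_sr_zero {n : ℕ} (hn : 3 ≤ n) {ω : ℂ} (hω : IsPrimitiveRoot ω n)
    (x : Matrix (Fin 2) (Fin 2) ℂ) :
    dihedralAction hn hω (.sr 0) x = !![0, 1; 1, 0] * x * !![0, 1; 1, 0] := by
  have h : dihedralAction hn hω (.sr 0)
      = conjAut ℂ (Matrix (Fin 2) (Fin 2) ℂ) reflectionUnit := by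
    simp [dihedralAction, dihedralLift]
  rw [h]
  rfl

end DihedralAction

/-! ### The ten identities -/

section DihedralIdentities

namespace DihedralIdentities

open FreeGAlgebra

/-- The idempotent `e_j = (1/n) ∑_{k < n} ω^{-jk} g^k` of the group algebra `ℂ D_n`. -/
noncomputable def e (n : ℕ) (ω : ℂ) (j : ℤ) : MonoidAlgebra ℂ (DihedralGroup n) :=
  ∑ k ∈ Finset.range n,
    MonoidAlgebra.single (DihedralGroup.r (k : ZMod n)) ((1 / (n : ℂ)) * ω ^ (-(j * (k : ℤ))))

/-- The reflection `h` as an element of the group algebra `ℂ D_n`. -/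
noncomputable def h (n : ℕ) : MonoidAlgebra ℂ (DihedralGroup n) :=
  MonoidAlgebra.single (DihedralGroup.sr 0) 1

/-- The variable `x_i` of `ℂ⟨X; D_n⟩`, where `X = {x_i | i ∈ ℕ}`. -/
noncomputable def x (n i : ℕ) : FreeGAlgebra ℂ ℕ (DihedralGroup n) :=
  FreeAlgebra.ι ℂ (i, 1)

/-- The ten `D_n`-identities; a relation `p = q` is represented by the polynomial `p - q`, and
`α` ranges over `±1`. -/
inductive IsOneOfTen (n : ℕ) (ω : ℂ) : FreeGAlgebra ℂ ℕ (DihedralGroup n) → Prop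
  | id1 : IsOneOfTen n ω (var ((1 + h n) * e n ω 0) 1)
  | id2 (α : ℤ) (hα : α = 1 ∨ α = -1) (f : MonoidAlgebra ℂ (DihedralGroup n))
      (hf : f = e n ω α ∨ f = h n * e n ω α) :
      IsOneOfTen n ω (var (e n ω 0) 1 * var f 2 + var f 2 * var (e n ω 0) 1)
  | id3 : IsOneOfTen n ω (var (e n ω 0) 1 + var (e n ω 1) 1 + var (e n ω (-1)) 1 - x n 1)
  | id4 : IsOneOfTen n ω
      (var (e n ω 0) 1 * var (e n ω 0) 2 - var (e n ω 0) 2 * var (e n ω 0) 1)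
  | id5 (α : ℤ) (hα : α = 1 ∨ α = -1) (f : MonoidAlgebra ℂ (DihedralGroup n))
      (hf : f = e n ω α ∨ f = h n * e n ω α) :
      IsOneOfTen n ω (var f 1 * var f 2)
  | id6 (α : ℤ) (hα : α = 1 ∨ α = -1) (f g : MonoidAlgebra ℂ (DihedralGroup n))
      (hfg : (f = e n ω α ∧ g = h n * e n ω (-α)) ∨ (f = h n * e n ω α ∧ g = e n ω (-α))) :
      IsOneOfTen n ω (var f 1 * var g 2)
  | id7 (α : ℤ) (hα : α = 1 ∨ α = -1) (f g : MonoidAlgebra ℂ (DihedralGroup n))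
      (hf : f = e n ω α ∨ f = h n * e n ω α) (hg : g = e n ω α ∨ g = h n * e n ω α) :
      IsOneOfTen n ω (var f 1 * x n 2 * var g 3 - var f 3 * x n 2 * var g 1)
  | id8 (α : ℤ) (hα : α = 1 ∨ α = -1) :
      IsOneOfTen n ω
        (var (e n ω α) 1 * x n 2 * var (h n * e n ω (-α)) 3
          - var (h n * e n ω (-α)) 3 * x n 2 * var (e n ω α) 1)
  | id9 (α : ℤ) (hα : α = 1 ∨ α = -1) :
      IsOneOfTen n ω
        (var (e n ω α) 1 * var (e n ω (-α)) 2
          - var (h n * e n ω (-α)) 2 * var (h n * e n ω α) 1)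
  | id10 (α : ℤ) (hα : α = 1 ∨ α = -1) :
      IsOneOfTen n ω
        (var (e n ω α) 1 * var (h n * e n ω α) 2 - var (e n ω α) 2 * var (h n * e n ω α) 1)

/-- The set of the ten `D_n`-identities (for all admissible `α`, `f`, `g`). -/
def identities (n : ℕ) (ω : ℂ) : Set (FreeGAlgebra ℂ ℕ (DihedralGroup n)) :=
  {p | IsOneOfTen n ω p}

end DihedralIdentities

end DihedralIdentities

/-!
The pair `(M₂(ℂ), sl₂(ℂ))` sees of a variable `x` only five things. For a traceless matrix with
diagonal entry `a` and off-diagonal entries `b` (upper right) and `c` (lower left), `e₀(x)` has the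
value `a (e₁₁ - e₂₂)`, while `e₁(x)` and `he₁(x)` have the values `c e₂₁` and `c e₁₂`, and
`he₋₁(x)` and `e₋₁(x)` the values `b e₂₁` and `b e₁₂`. Each of the ten relations holds for such
matrices (`isWeakGIdentity_of_mem_identities`).

For the converse, let `I` be a weak ideal that contains the ten polynomials. The substitutions
`x ↦ y ^ k` are endomorphisms of the pair (`isPairEndomorphism_subst`), so modulo `I` the relations
hold for all variables, with exponents multiplied from the right by any `k`. By `id1` and `id3`
every generator is then a combination of the five letters (`map_ι_mem_span_letters`). The relations
`id2`, `id4`, `id5` and `id10` then say that the letters `e₀(x)` commute with each other and anticommute with the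
off-diagonal letters, that off-diagonal letters with values in the same `ℂ e₁₂` or `ℂ e₂₁` multiply
to zero, and that the scalars can be exchanged between neighbouring letters of different types
(`isMatrixSystem_letters`). Hence a nonzero word alternates between the two types, and up to sign it
depends only on its first type and on the multiset of its letters (`IsMatrixSystem.altWord_perm`);
these normal words span modulo `I` (`map_mem_span_normalWords`).

In one row of its value, a normal word has the monomial of its scalars, up to sign; in the other row
it has zero, unless it is a product of letters `e₀(x)`. So the row sums of the values of a
combination of normal words, as polynomials in the entries `a`, `b`, `c`, determine the combination
modulo `I` (`exists_recover_eq`). For a weak identity these polynomials vanish at every point of an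
infinite field, so they are zero, and the identity lies in `I`.
-/

/-! ### Substitutions and evaluations of `u(x)` -/

namespace FreeGAlgebra

section General

attribute [local instance] LieRing.ofAssociativeRing

variable {F X G : Type*} [CommRing F]

theorem var_single (x : X) (k : G) (c : F) :
    var (MonoidAlgebra.single k c) x = c • FreeAlgebra.ι F (x, k) := by
  simp [var]

/-- The map `u ↦ u(x)` as a linear map on the group algebra. -/
noncomputable def varLinear (x : X) : MonoidAlgebra F G →ₗ[F] FreeGAlgebra F X G where
  toFun u := var u x
  map_add' u v := by
    simp only [var, MonoidAlgebra.coeff_add]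
    exact Finsupp.sum_add_index' (by simp) (fun _ _ _ => add_smul _ _ _)
  map_smul' c u := by
    simp only [var, MonoidAlgebra.coeff_smul, RingHom.id_apply, Finsupp.smul_sum]
    rw [Finsupp.sum_smul_index' (by simp)]
    simp only [smul_assoc]

theorem varLinear_apply (x : X) (u : MonoidAlgebra F G) : varLinear x u = var u x := rfl

variable [Group G]

/-- The endomorphism of `F⟨X; G⟩` that substitutes the variable `(σ x) ^ (τ x)` for `x`. As `G`
acts on exponents from the left, it multiplies the exponents of `x` by `τ x` from the right. -/
noncomputable def subst (σ : X → X) (τ : X → G) : FreeGAlgebra F X G →ₐ[F] FreeGAlgebra F X G :=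
  FreeAlgebra.lift F fun p => FreeAlgebra.ι F (σ p.1, p.2 * τ p.1)

theorem subst_ι (σ : X → X) (τ : X → G) (x : X) (k : G) :
    subst σ τ (FreeAlgebra.ι F (x, k)) = FreeAlgebra.ι F (σ x, k * τ x) := by
  simp [subst]

theorem subst_var (σ : X → X) (τ : X → G) (u : MonoidAlgebra F G) (x : X) :
    subst σ τ (var u x) = var (u * MonoidAlgebra.single (τ x) 1) (σ x) := by
  have key : (subst σ τ).toLinearMap ∘ₗ varLinear x
      = varLinear (σ x) ∘ₗ LinearMap.mulRight F (MonoidAlgebra.single (τ x) (1 : F)) := by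
    ext k
    simp [varLinear_apply, var_single, subst_ι, MonoidAlgebra.single_mul_single]
  exact LinearMap.congr_fun key u

theorem isPairEndomorphism_subst (σ : X → X) (τ : X → G) :
    IsPairEndomorphism (subst (F := F) σ τ) where
  map_act k f := by
    have key : (subst (F := F) σ τ).comp (act k) = (act k).comp (subst σ τ) := by
      ext p
      simp [act, subst, mul_assoc]
    exact AlgHom.congr_fun key f
  map_lie f hf := by
    have key : lie F X G ≤ (lie F X G).comap (subst (F := F) σ τ).toLieHom := by
      refine LieSubalgebra.lieSpan_le.2 ?_
      rintro _ ⟨p, rfl⟩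
      change subst σ τ (FreeAlgebra.ι F (p.1, p.2)) ∈ lie F X G
      rw [subst_ι]
      exact LieSubalgebra.subset_lieSpan ⟨_, rfl⟩
    exact key hf

variable {A : Type*} [Ring A] [Algebra F A]

/-- The module structure over the group algebra given by an action of `G` on `A`. -/
noncomputable def groupAlgebraAction (φ : G →* (A ≃ₐ[F] A)) :
    MonoidAlgebra F G →ₐ[F] Module.End F A :=
  MonoidAlgebra.lift F (Module.End F A) G
    { toFun := fun k => (φ k).toLinearMap
      map_one' := by ext; simp
      map_mul' := fun k l => by ext; simp }

theorem groupAlgebraAction_single (φ : G →* (A ≃ₐ[F] A)) (k : G) (c : F) (y : A) :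
    groupAlgebraAction φ (MonoidAlgebra.single k c) y = c • φ k y := by
  simp [groupAlgebraAction]

theorem eval_ι (φ : G →* (A ≃ₐ[F] A)) (a : X → A) (x : X) (k : G) :
    eval φ a (FreeAlgebra.ι F (x, k)) = φ k (a x) := by
  simp [eval]

theorem eval_var (φ : G →* (A ≃ₐ[F] A)) (a : X → A) (u : MonoidAlgebra F G) (x : X) :
    eval φ a (var u x) = groupAlgebraAction φ u (a x) := by
  have key : (eval φ a).toLinearMap ∘ₗ varLinear x
      = LinearMap.applyₗ (a x) ∘ₗ (groupAlgebraAction φ).toLinearMap := by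
    ext k
    simp [varLinear_apply, var_single, eval_ι, groupAlgebraAction_single]
  exact LinearMap.congr_fun key u

theorem eval_act (φ : G →* (A ≃ₐ[F] A)) (a : X → A) (k : G) (f : FreeGAlgebra F X G) :
    eval φ a (act k f) = φ k (eval φ a f) := by
  have key : (eval φ a).comp (act k) = (φ k : A →ₐ[F] A).comp (eval φ a) := by
    ext p
    simp [act, eval]
  exact AlgHom.congr_fun key f

theorem mem_weakGIdentities {φ : G →* (A ≃ₐ[F] A)} {L : LieSubalgebra F A}
    {f : FreeGAlgebra F X G} : f ∈ weakGIdentities X φ L ↔ IsWeakGIdentity φ L f :=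
  TwoSidedIdeal.mem_mk' _ _ _ _ _ _ _

/-- Evaluating after an endomorphism of the pair amounts to another evaluation in `L`, so the weak
`G`-identities of a `G`-stable `L` form a weak `G`-ideal. -/
theorem isWeakGIdeal_weakGIdentities (φ : G →* (A ≃ₐ[F] A)) (L : LieSubalgebra F A)
    (hL : ∀ k, ∀ y ∈ L, φ k y ∈ L) : IsWeakGIdeal (weakGIdentities X φ L) := by
  intro ψ hψ f hf
  rw [mem_weakGIdentities] at hf ⊢
  intro a ha
  have hlie : lie F X G ≤ L.comap (eval φ a).toLieHom := by
    refine LieSubalgebra.lieSpan_le.2 ?_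
    rintro _ ⟨p, rfl⟩
    change eval φ a (FreeAlgebra.ι F (p.1, p.2)) ∈ L
    rw [eval_ι]
    exact hL _ _ (ha _)
  have key : (eval φ a).comp ψ
      = eval φ fun x => eval φ a (ψ (FreeAlgebra.ι F (x, 1))) := by
    ext ⟨x, k⟩
    have h1 : FreeAlgebra.ι F (x, k) = act k (FreeAlgebra.ι F (x, (1 : G))) := by simp [act]
    simp only [Function.comp_apply, AlgHom.coe_comp, eval_ι]
    rw [h1, hψ.map_act, eval_act]
  rw [← AlgHom.comp_apply, key]
  exact hf _ fun x => hlie (hψ.map_lie _ (LieSubalgebra.subset_lieSpan ⟨_, rfl⟩))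

end General

end FreeGAlgebra

/-! ### Alternating words -/

section AlternatingWords

/-- The relations of a matrix-like system in a ring: `H x` plays the part of a multiple of
`e₁₁ - e₂₂`, and `C true y`, `C false y` those of multiples of `e₁₂` and `e₂₁` with a common
scalar depending on `y`. -/
structure IsMatrixSystem {Q A Y : Type*} [Ring Q] (H : A → Q) (C : Bool → Y → Q) : Prop where
  comm : ∀ x y, H x * H y = H y * H x
  anti : ∀ d x y, H x * C d y = -(C d y * H x)
  nil : ∀ d y z, C d y * C d z = 0
  exch : ∀ d y z, C d y * C (!d) z = C d z * C (!d) y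

variable {Q A Y : Type*} [Ring Q] (H : A → Q) (C : Bool → Y → Q)

/-- The word spelled by a list of letters, in which the letters of type `C` alternate, the first
one being `C d`. The letter `H x` enters with the sign of its eigenvalue on the row `d` that it
acts on; with these signs the word does not depend on the order of the list. -/
def altWord : Bool → List (A ⊕ Y) → Q
  | _, [] => 1
  | d, .inl x :: l => (bif d then H x else -H x) * altWord d l
  | d, .inr y :: l => C d y * altWord (!d) l

theorem map_altWord {R' : Type*} [Ring R'] {E : Type*} [FunLike E Q R'] [RingHomClass E Q R']
    (π : E) (d : Bool) (l : List (A ⊕ Y)) :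
    π (altWord H C d l) = altWord (fun x => π (H x)) (fun b y => π (C b y)) d l := by
  induction l generalizing d with
  | nil => simp [altWord]
  | cons s l ih => rcases s with x | y <;> cases d <;> simp [altWord, ih]

variable {H C}

theorem IsMatrixSystem.altWord_perm (h : IsMatrixSystem H C) {l l' : List (A ⊕ Y)}
    (hl : l.Perm l') (d : Bool) : altWord H C d l = altWord H C d l' := by
  induction hl generalizing d with
  | nil => rfl
  | cons s _ ih => rcases s with x | y <;> simp only [altWord, ih]
  | swap s t l =>
    rcases s with x | y <;> rcases t with x' | y' <;> simp only [altWord, ← mul_assoc]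
    · congr 1
      cases d <;> simp [h.comm x x']
    · congr 1
      cases d <;> simp [h.anti]
    · congr 1
      cases d <;> simp [h.anti]
    · rw [h.exch]
  | trans _ _ ih₁ ih₂ => exact (ih₁ d).trans (ih₂ d)

/-- Without letters of type `C`, the words of the two rows agree up to sign. -/
theorem altWord_false_of_forall_isLeft {l : List (A ⊕ Y)} (hl : ∀ s ∈ l, s.isLeft) :
    altWord H C false l = (-1) ^ l.length * altWord H C true l := by
  induction l with
  | nil => simp [altWord]
  | cons s l ih =>
    rcases s with x | y
    · have hc : H x * (-1) ^ l.length = (-1) ^ l.length * H x :=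
        (((Commute.one_right (H x)).neg_right).pow_right _).eq
      simp [altWord, ih fun s hs => hl s (by simp [hs]), pow_succ, ← mul_assoc, hc]
    · simpa using hl (.inr y) (by simp)

theorem IsMatrixSystem.mul_altWord_eq_zero (h : IsMatrixSystem H C) {l : List (A ⊕ Y)}
    (hl : ¬ ∀ s ∈ l, s.isLeft) (d : Bool) (y : Y) : C d y * altWord H C d l = 0 := by
  push Not at hl
  obtain ⟨s, hs, hs'⟩ := hl
  rcases s with x | z
  · simp at hs'
  obtain ⟨l₁, l₂, rfl⟩ := List.append_of_mem hs
  rw [h.altWord_perm List.perm_middle, altWord, ← mul_assoc, h.nil, zero_mul]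

variable (H C) in
/-- The normal words: all words whose first `C`-letter may be `C true`, and those which do have a
`C`-letter, the first one being `C false`. -/
def normalWords : Set Q :=
  {w | ∃ d l, (d = false → ¬ ∀ s ∈ l, s.isLeft) ∧ w = altWord H C d l}

theorem IsMatrixSystem.mul_mem_span (h : IsMatrixSystem H C) {𝕜 : Type*} [CommRing 𝕜]
    [Algebra 𝕜 Q] {w : Q} (hw : w ∈ Submodule.span 𝕜 (normalWords H C)) :
    (∀ x, H x * w ∈ Submodule.span 𝕜 (normalWords H C)) ∧
      ∀ d y, C d y * w ∈ Submodule.span 𝕜 (normalWords H C) := by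
  induction hw using Submodule.span_induction with
  | mem w hw =>
    obtain ⟨d, l, hd, rfl⟩ := hw
    constructor
    · intro x
      have hmem : altWord H C d (.inl x :: l) ∈ Submodule.span 𝕜 (normalWords H C) :=
        Submodule.subset_span ⟨d, _, fun hd' => by simpa using hd hd', rfl⟩
      cases d
      · simpa [altWord] using neg_mem hmem
      · simpa [altWord] using hmem
    · intro b y
      by_cases hbd : b = d
      · subst hbd
        by_cases hl : ∀ s ∈ l, s.isLeft
        · cases b
          · exact absurd hl (hd rfl)
          · have hmem : altWord H C true (.inr y :: l) ∈ Submodule.span 𝕜 (normalWords H C) :=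
              Submodule.subset_span ⟨true, _, by simp, rfl⟩
            rw [altWord, Bool.not_true, altWord_false_of_forall_isLeft hl] at hmem
            rcases neg_one_pow_eq_or Q l.length with e | e
            · simpa [e] using hmem
            · simpa [e] using neg_mem hmem
        · rw [h.mul_altWord_eq_zero hl]
          exact zero_mem _
      · obtain rfl : d = !b := Bool.eq_not.2 (Ne.symm hbd)
        exact Submodule.subset_span ⟨b, .inr y :: l, by simp, rfl⟩
  | zero => simp
  | add u v _ _ hu hv =>
    simp only [mul_add]
    exact ⟨fun x => add_mem (hu.1 x) (hv.1 x), fun d y => add_mem (hu.2 d y) (hv.2 d y)⟩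
  | smul c u _ hu =>
    simp only [mul_smul_comm]
    exact ⟨fun x => Submodule.smul_mem _ _ (hu.1 x), fun d y => Submodule.smul_mem _ _ (hu.2 d y)⟩

theorem one_mem_span_normalWords {𝕜 : Type*} [CommRing 𝕜] [Algebra 𝕜 Q] :
    (1 : Q) ∈ Submodule.span 𝕜 (normalWords H C) :=
  Submodule.subset_span ⟨true, [], by simp, rfl⟩

end AlternatingWords

/-! ### The idempotents `e_j` in the group algebra -/

namespace DihedralIdentities

open FreeGAlgebra

section GroupAlgebra

variable {n : ℕ} {ω : ℂ}

theorem h_mul_h : h n * h n = 1 := by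
  rw [h, MonoidAlgebra.single_mul_single, MonoidAlgebra.one_def]
  simp

/-- A sum over a period is invariant under a shift. -/
theorem sum_range_shift {M : Type*} [AddCommGroup M] (F : ℕ → M) (hF : F n = F 0) :
    ∑ k ∈ Finset.range n, F (k + 1) = ∑ k ∈ Finset.range n, F k := by
  have h1 := Finset.sum_range_succ F n
  rw [Finset.sum_range_succ', hF] at h1
  exact add_right_cancel h1

theorem e_mul_single_r_one (hω : IsPrimitiveRoot ω n) (h0 : ω ≠ 0) (j : ℤ) :
    e n ω j * MonoidAlgebra.single (.r 1) 1 = ω ^ j • e n ω j := by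
  have hn : ω ^ (n : ℤ) = 1 := by simpa using hω.pow_eq_one
  rw [e, Finset.sum_mul, Finset.smul_sum]
  refine Eq.trans ?_ (sum_range_shift (fun k : ℕ => ω ^ j • MonoidAlgebra.single
    (DihedralGroup.r (k : ZMod n)) (1 / (n : ℂ) * ω ^ (-(j * (k : ℤ))))) ?_)
  · refine Finset.sum_congr rfl fun k _ => ?_
    rw [MonoidAlgebra.single_mul_single, MonoidAlgebra.smul_single, DihedralGroup.r_mul_r,
      mul_one, smul_eq_mul, mul_left_comm, ← zpow_add₀ h0]
    push_cast
    ring_nf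
  · rw [show -(j * ((n : ℕ) : ℤ)) = n * (-j) by ring, zpow_mul, hn]
    simp

theorem e_mul_single_r (hω : IsPrimitiveRoot ω n) (h0 : ω ≠ 0) (j : ℤ) (i : ℕ) :
    e n ω j * MonoidAlgebra.single (.r (i : ZMod n)) 1 = ω ^ (j * i) • e n ω j := by
  induction i with
  | zero => simp [← MonoidAlgebra.one_def]
  | succ i ih =>
    have : (MonoidAlgebra.single (.r ((i + 1 : ℕ) : ZMod n)) 1 : MonoidAlgebra ℂ (DihedralGroup n))
        = MonoidAlgebra.single (.r (i : ZMod n)) 1 * MonoidAlgebra.single (.r 1) 1 := by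
      simp [MonoidAlgebra.single_mul_single]
    rw [this, ← mul_assoc, ih, smul_mul_assoc, e_mul_single_r_one hω h0, smul_smul, ← zpow_add₀ h0]
    push_cast
    rw [mul_add, mul_one]

theorem e_mul_h (hω : IsPrimitiveRoot ω n) (h0 : ω ≠ 0) (j : ℤ) :
    e n ω j * h n = h n * e n ω (-j) := by
  have hn : ω ^ (n : ℤ) = 1 := by simpa using hω.pow_eq_one
  simp only [e, h, Finset.sum_mul, Finset.mul_sum, MonoidAlgebra.single_mul_single, mul_one, one_mul,
    DihedralGroup.r_mul_sr, DihedralGroup.sr_mul_r, zero_sub, zero_add]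
  rw [← sum_range_shift, ← Finset.sum_range_reflect]
  · refine Finset.sum_congr rfl fun k hk => ?_
    have hk' : k < n := Finset.mem_range.1 hk
    have h1 : n - 1 - k + 1 = n - k := by omega
    rw [h1, Nat.cast_sub hk'.le, Nat.cast_sub hk'.le]
    congr 2
    · simp
    · rw [show -(j * ((n : ℤ) - k)) = n * (-j) + -(-j * k) by ring, zpow_add₀ h0, zpow_mul, hn]
      simp
  · rw [show -(j * ((n : ℕ) : ℤ)) = n * (-j) by ring, zpow_mul, hn]
    simp

end GroupAlgebra

/-! ### The action of the idempotents on `2 × 2` matrices -/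

section Matrices

variable {n : ℕ} (hn : 3 ≤ n) {ω : ℂ} (hω : IsPrimitiveRoot ω n)

theorem dihedralAction_r_natCast (k : ℕ) (X : Matrix (Fin 2) (Fin 2) ℂ) :
    dihedralAction hn hω (.r (k : ZMod n)) X
      = !![X 0 0, ω ^ (-1 * k : ℤ) * X 0 1; ω ^ (1 * k : ℤ) * X 1 0, X 1 1] := by
  have h0 : ω ≠ 0 := hω.ne_zero (by omega)
  induction k with
  | zero =>
    rw [Nat.cast_zero, ← DihedralGroup.one_def, map_one]
    simp [← Matrix.eta_fin_two]
  | succ k ih =>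
    have : DihedralGroup.r ((k + 1 : ℕ) : ZMod n) = .r 1 * .r (k : ZMod n) := by
      simp [add_comm]
    rw [this, map_mul, AlgEquiv.mul_apply, ih, dihedralAction_r_one]
    ext i j
    fin_cases i <;> fin_cases j <;> simp [Matrix.mul_apply, h0, zpow_add₀] <;> field_simp

theorem dihedralAction_sr_zero_eq (X : Matrix (Fin 2) (Fin 2) ℂ) :
    dihedralAction hn hω (.sr 0) X = !![X 1 1, X 1 0; X 0 1, X 0 0] := by
  rw [dihedralAction_sr_zero]
  ext i j
  fin_cases i <;> fin_cases j <;> simp [Matrix.mul_apply, Matrix.vecMul] <;> rfl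

include hω in
/-- Orthogonality of the characters of the rotation subgroup. -/
theorem sum_range_character (j m : ℤ) (hjm : |m - j| < n) (hn : n ≠ 0) :
    ∑ k ∈ Finset.range n, 1 / (n : ℂ) * ω ^ (-(j * (k : ℤ))) * ω ^ (m * k : ℤ)
      = if m = j then 1 else 0 := by
  have h0 : ω ≠ 0 := hω.ne_zero hn
  have h1 : ∀ k : ℕ, 1 / (n : ℂ) * ω ^ (-(j * (k : ℤ))) * ω ^ (m * k : ℤ)
      = 1 / (n : ℂ) * (ω ^ (m - j)) ^ k := fun k => by
    rw [mul_assoc, ← zpow_add₀ h0, ← zpow_natCast, ← zpow_mul]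
    ring_nf
  simp only [h1, ← Finset.mul_sum]
  split_ifs with hmj
  · simp [hmj, hn]
  · have h2 : ω ^ (m - j) ≠ 1 := by
      rw [Ne, hω.zpow_eq_one_iff_dvd]
      exact fun hd => hmj (sub_eq_zero.1 (Int.eq_zero_of_abs_lt_dvd hd hjm))
    rw [geom_sum_eq h2, ← zpow_natCast, ← zpow_mul, mul_comm (m - j), zpow_mul, zpow_natCast,
      hω.pow_eq_one]
    simp

/-- `e_j` projects onto the weight space of weight `j`: the diagonal for `j = 0`, the multiples of
`e₁₂` for `j = -1` and those of `e₂₁` for `j = 1`. -/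
theorem groupAlgebraAction_e (j : ℤ) (hj : |j| ≤ 1) (X : Matrix (Fin 2) (Fin 2) ℂ) :
    groupAlgebraAction (dihedralAction hn hω) (e n ω j) X
      = !![if 0 = j then X 0 0 else 0, if -1 = j then X 0 1 else 0;
          if 1 = j then X 1 0 else 0, if 0 = j then X 1 1 else 0] := by
  have hb := abs_le.1 hj
  have key : ∀ m : ℤ, |m| ≤ 1 → ∀ z : ℂ, ∑ k ∈ Finset.range n,
      1 / (n : ℂ) * ω ^ (-(j * (k : ℤ))) * (ω ^ (m * k : ℤ) * z) = if m = j then z else 0 := by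
    intro m hm z
    have hb' := abs_le.1 hm
    simp only [← mul_assoc, ← Finset.sum_mul]
    rw [sum_range_character hω j m (abs_lt.2 ⟨by omega, by omega⟩) (by omega)]
    simp
  have key0 := fun z : ℂ => key 0 (by simp) z
  simp only [zero_mul, zpow_zero, one_mul] at key0
  simp only [e, map_sum, LinearMap.sum_apply, groupAlgebraAction_single, dihedralAction_r_natCast]
  ext i i'
  fin_cases i <;> fin_cases i'
  · simpa [Matrix.sum_apply] using key0 (X 0 0)
  · simpa [Matrix.sum_apply] using key (-1) (by simp) (X 0 1)
  · simpa [Matrix.sum_apply] using key 1 (by simp) (X 1 0)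
  · simpa [Matrix.sum_apply] using key0 (X 1 1)

theorem groupAlgebraAction_h (X : Matrix (Fin 2) (Fin 2) ℂ) :
    groupAlgebraAction (dihedralAction hn hω) (h n) X = !![X 1 1, X 1 0; X 0 1, X 0 0] := by
  rw [h, groupAlgebraAction_single, one_smul, dihedralAction_sr_zero_eq]

theorem trace_dihedralAction (k : DihedralGroup n) (X : Matrix (Fin 2) (Fin 2) ℂ) :
    (dihedralAction hn hω k X).trace = X.trace := by
  have : NeZero n := ⟨by omega⟩
  have hr : ∀ (i : ZMod n) (Y : Matrix (Fin 2) (Fin 2) ℂ),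
      (dihedralAction hn hω (.r i) Y).trace = Y.trace := fun i Y => by
    obtain ⟨m, rfl⟩ := ZMod.natCast_zmod_surjective i
    rw [dihedralAction_r_natCast]
    simp [Matrix.trace_fin_two]
  rcases k with i | i
  · exact hr i X
  · rw [show DihedralGroup.sr i = .sr 0 * .r i by simp, map_mul, AlgEquiv.mul_apply,
      dihedralAction_sr_zero_eq, ← hr i X]
    simp only [Matrix.trace_fin_two, Matrix.of_apply, Matrix.cons_val]
    exact add_comm _ _

end Matrices

/-! ### The letters -/

section Letters

/-- The right translation attached to a sign: the identity, or the reflection `h`. -/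
def reflect (n : ℕ) (s : Bool) : DihedralGroup n := bif s then 1 else .sr 0

/-- The letter `x ↦ e₀(x)`, whose values are multiples of `e₁₁ - e₂₂`. -/
noncomputable def diagLetter (n : ℕ) (ω : ℂ) (x : ℕ) : FreeGAlgebra ℂ ℕ (DihedralGroup n) :=
  var (e n ω 0) x

/-- The group algebra element of a letter: `h e₁` for `true`, with values in `ℂ e₁₂`, and `e₁` for
`false`, with values in `ℂ e₂₁`. -/
noncomputable def offDiagElement (n : ℕ) (ω : ℂ) (d : Bool) : MonoidAlgebra ℂ (DihedralGroup n) :=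
  bif d then h n * e n ω 1 else e n ω 1

/-- The off-diagonal letters. For `y = (x, true)` they are `he₁(x)` and `e₁(x)`, with values
`c e₁₂` and `c e₂₁` for the lower left entry `c` of the matrix substituted for `x`; for
`y = (x, false)` they are `e₋₁(x)` and `he₋₁(x)`, and `c` is the upper right entry. Writing the
latter as the former with `x ^ h` in place of `x` makes one substitution cover both. -/
noncomputable def offDiagLetter (n : ℕ) (ω : ℂ) (d : Bool) (y : ℕ × Bool) :
    FreeGAlgebra ℂ ℕ (DihedralGroup n) :=
  var (offDiagElement n ω d * MonoidAlgebra.single (reflect n y.2) 1) y.1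

variable {n : ℕ} {ω : ℂ}

theorem single_one : (MonoidAlgebra.single 1 1 : MonoidAlgebra ℂ (DihedralGroup n)) = 1 := rfl

theorem offDiagLetter_true_true (x : ℕ) :
    offDiagLetter n ω true (x, true) = var (h n * e n ω 1) x := by
  simp [offDiagLetter, offDiagElement, reflect, single_one]

theorem offDiagLetter_false_true (x : ℕ) :
    offDiagLetter n ω false (x, true) = var (e n ω 1) x := by
  simp [offDiagLetter, offDiagElement, reflect, single_one]

theorem offDiagLetter_true_false (hω : IsPrimitiveRoot ω n) (h0 : ω ≠ 0) (x : ℕ) :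
    offDiagLetter n ω true (x, false) = var (e n ω (-1)) x := by
  have h1 := e_mul_h hω h0 1
  rw [h] at h1
  simp only [offDiagLetter, offDiagElement, reflect, mul_assoc, cond_true, cond_false, h1]
  rw [← h, ← mul_assoc, h_mul_h, one_mul]

theorem offDiagLetter_false_false (hω : IsPrimitiveRoot ω n) (h0 : ω ≠ 0) (x : ℕ) :
    offDiagLetter n ω false (x, false) = var (h n * e n ω (-1)) x := by
  have h1 := e_mul_h hω h0 1
  rw [h] at h1
  simp only [offDiagLetter, offDiagElement, reflect, cond_false, h1]
  rw [← h]

end Letters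

/-! ### Consequences of the ten identities -/

section Relations

variable {n : ℕ} {ω : ℂ} {Q : Type*} [Ring Q] [Algebra ℂ Q]
  {π : FreeGAlgebra ℂ ℕ (DihedralGroup n) →ₐ[ℂ] Q}

/-- The relations between the letters need only `id2`, `id4`, `id5` and `id10`: since the exponents
of the variables of an identity can be multiplied from the right by `1` or `h`, independently for
each variable, an identity for `e₁` and `he₁` gives all the cases with other signs. -/
theorem isMatrixSystem_letters (hω : IsPrimitiveRoot ω n) (h0 : ω ≠ 0)
    (hπ : ∀ p ∈ identities n ω, ∀ σ τ, π (subst σ τ p) = 0) :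
    IsMatrixSystem (fun x => π (diagLetter n ω x)) (fun d y => π (offDiagLetter n ω d y)) := by
  have hsub : ∀ (x y : ℕ) (s t : DihedralGroup n), ∃ ψ : FreeGAlgebra ℂ ℕ (DihedralGroup n) →ₐ[ℂ]
      FreeGAlgebra ℂ ℕ (DihedralGroup n), (∀ p ∈ identities n ω, π (ψ p) = 0) ∧
      (∀ u, ψ (var u 1) = var (u * MonoidAlgebra.single s 1) x) ∧
      ∀ u, ψ (var u 2) = var (u * MonoidAlgebra.single t 1) y := fun x y s t =>
    ⟨subst (fun i => if i = 1 then x else y) (fun i => if i = 1 then s else t),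
      fun p hp => hπ p hp _ _, fun u => by simp [subst_var], fun u => by simp [subst_var]⟩
  constructor
  · intro x y
    obtain ⟨ψ, h1, h2, h3⟩ := hsub x y 1 1
    have := h1 _ .id4
    rw [map_sub, map_mul, map_mul, h2, h3, single_one, mul_one] at this
    simpa [diagLetter, sub_eq_zero] using this
  · intro d x y
    obtain ⟨ψ, h1, h2, h3⟩ := hsub x y.1 1 (reflect n y.2)
    have := h1 _ (.id2 1 (.inl rfl) (offDiagElement n ω d) (by cases d <;> simp [offDiagElement]))
    rw [map_add, map_mul, map_mul, h2, h3, single_one, mul_one] at this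
    simpa [diagLetter, offDiagLetter, add_eq_zero_iff_eq_neg] using this
  · intro d y z
    obtain ⟨ψ, h1, h2, h3⟩ := hsub y.1 z.1 (reflect n y.2) (reflect n z.2)
    have := h1 _ (.id5 1 (.inl rfl) (offDiagElement n ω d) (by cases d <;> simp [offDiagElement]))
    rw [map_mul, h2, h3] at this
    simpa [offDiagLetter] using this
  · intro d y z
    cases d
    · obtain ⟨ψ, h1, h2, h3⟩ := hsub y.1 z.1 (reflect n y.2) (reflect n z.2)
      have := h1 _ (.id10 1 (.inl rfl))
      rw [map_sub, map_mul, map_mul, h2, h3, h2, h3] at this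
      simpa [offDiagLetter, offDiagElement, sub_eq_zero] using this
    -- The other order of rows comes from `α = -1`, as `e₋₁h = he₁` and `he₋₁h = e₁`.
    · obtain ⟨ψ, h1, h2, h3⟩ := hsub y.1 z.1 (.sr 0 * reflect n y.2) (.sr 0 * reflect n z.2)
      have := h1 _ (.id10 (-1) (.inr rfl))
      have hs : ∀ t, (MonoidAlgebra.single (DihedralGroup.sr 0 * t) 1 :
          MonoidAlgebra ℂ (DihedralGroup n)) = h n * MonoidAlgebra.single t 1 := fun t => by
        simp [h, MonoidAlgebra.single_mul_single]
      have he : e n ω (-1) * h n = h n * e n ω 1 := by simpa using e_mul_h hω h0 (-1)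
      have he' : h n * e n ω (-1) * h n = e n ω 1 := by
        rw [mul_assoc, he, ← mul_assoc, h_mul_h, one_mul]
      rw [map_sub, map_mul, map_mul, h2, h3, h2, h3] at this
      simp only [hs, ← mul_assoc, he, he'] at this
      simpa [offDiagLetter, offDiagElement, sub_eq_zero] using this

theorem single_sr (i : ZMod n) : (MonoidAlgebra.single (.sr i) 1 :
    MonoidAlgebra ℂ (DihedralGroup n)) = h n * MonoidAlgebra.single (.r i) 1 := by
  simp [h, MonoidAlgebra.single_mul_single]

/-- By `id1` and `id3`, every generator is a combination of letters. -/
theorem map_ι_mem_span_letters [NeZero n] (hω : IsPrimitiveRoot ω n) (h0 : ω ≠ 0)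
    (hπ : ∀ p ∈ identities n ω, ∀ σ τ, π (subst σ τ p) = 0) (x : ℕ) (k : DihedralGroup n) :
    π (FreeAlgebra.ι ℂ (x, k)) ∈ Submodule.span ℂ
      (Set.range (fun x => π (diagLetter n ω x)) ∪
        Set.range fun b : Bool × ℕ × Bool => π (offDiagLetter n ω b.1 b.2)) := by
  set S := Submodule.span ℂ (Set.range (fun x => π (diagLetter n ω x)) ∪
        Set.range fun b : Bool × ℕ × Bool => π (offDiagLetter n ω b.1 b.2)) with hS
  have hH : π (var (e n ω 0) x) ∈ S := Submodule.subset_span (.inl ⟨x, rfl⟩)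
  have hC : ∀ d s, π (offDiagLetter n ω d (x, s)) ∈ S := fun d s =>
    Submodule.subset_span (.inr ⟨(d, x, s), rfl⟩)
  have hP : π (var (e n ω 1) x) ∈ S := offDiagLetter_false_true (n := n) x ▸ hC false true
  have hP' : π (var (h n * e n ω 1) x) ∈ S :=
    offDiagLetter_true_true (n := n) x ▸ hC true true
  have hN : π (var (e n ω (-1)) x) ∈ S := offDiagLetter_true_false hω h0 x ▸ hC true false
  have hN' : π (var (h n * e n ω (-1)) x) ∈ S :=
    offDiagLetter_false_false hω h0 x ▸ hC false false
  have hH' : π (var (h n * e n ω 0) x) ∈ S := by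
    have := hπ _ .id1 (fun _ => x) (fun _ => 1)
    rw [subst_var, single_one, mul_one, add_mul, one_mul, ← varLinear_apply, map_add, map_add,
      varLinear_apply, varLinear_apply, add_comm, add_eq_zero_iff_eq_neg] at this
    exact this ▸ neg_mem hH
  have h3 := hπ _ .id3 (fun _ => x) (fun _ => k)
  rw [map_sub, map_add, map_add, subst_var, subst_var, subst_var, DihedralIdentities.x, subst_ι,
    one_mul, map_sub, sub_eq_zero] at h3
  rw [← h3, map_add, map_add]
  rcases k with i | i
  · obtain ⟨m, rfl⟩ := ZMod.natCast_zmod_surjective i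
    simp only [e_mul_single_r hω h0, ← varLinear_apply, map_smul]
    exact add_mem (add_mem (S.smul_mem _ hH) (S.smul_mem _ hP)) (S.smul_mem _ hN)
  · obtain ⟨m, rfl⟩ := ZMod.natCast_zmod_surjective i
    simp only [single_sr, ← mul_assoc, e_mul_h hω h0]
    simp only [mul_assoc, e_mul_single_r hω h0, ← varLinear_apply, map_smul, mul_smul_comm]
    simp only [varLinear_apply, neg_zero, neg_neg]
    exact add_mem (add_mem (S.smul_mem _ hH') (S.smul_mem _ hN')) (S.smul_mem _ hP')

/-- Modulo the ten identities, every polynomial is a combination of normal words. -/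
theorem map_mem_span_normalWords [NeZero n] (hω : IsPrimitiveRoot ω n) (h0 : ω ≠ 0)
    (hπ : ∀ p ∈ identities n ω, ∀ σ τ, π (subst σ τ p) = 0)
    (f : FreeGAlgebra ℂ ℕ (DihedralGroup n)) :
    π f ∈ Submodule.span ℂ (normalWords (fun x => π (diagLetter n ω x))
      (fun d y => π (offDiagLetter n ω d y))) := by
  set N := Submodule.span ℂ (normalWords (fun x => π (diagLetter n ω x))
      (fun d y => π (offDiagLetter n ω d y)))
  suffices h : ∀ w ∈ N, π f * w ∈ N by simpa using h 1 one_mem_span_normalWords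
  induction f using FreeAlgebra.induction with
  | grade0 c =>
    intro w hw
    rw [AlgHom.commutes, ← Algebra.smul_def]
    exact N.smul_mem _ hw
  | grade1 p =>
    intro w hw
    have hsys := (isMatrixSystem_letters hω h0 hπ).mul_mem_span hw
    obtain ⟨x, k⟩ := p
    have hz := map_ι_mem_span_letters hω h0 hπ x k
    generalize π (FreeAlgebra.ι ℂ (x, k)) = z at hz
    induction hz using Submodule.span_induction with
    | mem z hz =>
      rcases hz with ⟨x, rfl⟩ | ⟨b, rfl⟩
      · exact hsys.1 x
      · exact hsys.2 b.1 b.2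
    | zero => simp
    | add u v _ _ hu hv => rw [add_mul]; exact add_mem hu hv
    | smul c u _ hu => rw [smul_mul_assoc]; exact N.smul_mem _ hu
  | mul a b ha hb =>
    intro w hw
    rw [map_mul, mul_assoc]
    exact ha _ (hb _ hw)
  | add a b ha hb =>
    intro w hw
    rw [map_add, add_mul]
    exact add_mem (ha _ hw) (hb _ hw)

end Relations

/-! ### Evaluation of normal words at traceless matrices -/

section Evaluation

variable {n : ℕ} (hn : 3 ≤ n) {ω : ℂ} (hω : IsPrimitiveRoot ω n)

/-- The traceless matrices whose entries are the values of `p`: the coordinates `inl x`,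
`inr (x, false)` and `inr (x, true)` are the upper left, upper right and lower left entry of the
matrix substituted for `x`. -/
def pointMatrix (p : ℕ ⊕ ℕ × Bool → ℂ) (x : ℕ) : Matrix (Fin 2) (Fin 2) ℂ :=
  !![p (.inl x), p (.inr (x, false)); p (.inr (x, true)), -p (.inl x)]

/-- Evaluation of `D_n`-polynomials at the traceless matrices with entries `p`. -/
noncomputable def evalPoint (p : ℕ ⊕ ℕ × Bool → ℂ) :
    FreeGAlgebra ℂ ℕ (DihedralGroup n) →ₐ[ℂ] Matrix (Fin 2) (Fin 2) ℂ :=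
  FreeGAlgebra.eval (dihedralAction hn hω) (pointMatrix p)

theorem evalPoint_diagLetter (p : ℕ ⊕ ℕ × Bool → ℂ) (x : ℕ) :
    evalPoint hn hω p (diagLetter n ω x) = !![p (.inl x), 0; 0, -p (.inl x)] := by
  rw [evalPoint, diagLetter, eval_var, groupAlgebraAction_e _ _ _ (by simp)]
  simp [pointMatrix]

theorem evalPoint_offDiagLetter (p : ℕ ⊕ ℕ × Bool → ℂ) (d : Bool) (y : ℕ × Bool) :
    evalPoint hn hω p (offDiagLetter n ω d y)
      = bif d then !![0, p (.inr y); 0, 0] else !![0, 0; p (.inr y), 0] := by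
  have h0 : ω ≠ 0 := hω.ne_zero (by omega)
  obtain ⟨x, s⟩ := y
  rw [evalPoint]
  cases d <;> cases s <;>
    simp [offDiagLetter_true_true, offDiagLetter_false_true, offDiagLetter_true_false hω h0,
      offDiagLetter_false_false hω h0, eval_var, groupAlgebraAction_e, groupAlgebraAction_h,
      pointMatrix]

/-- The sum of the entries of the first (`true`) or second (`false`) row of a matrix. -/
def rowSum (d : Bool) : Matrix (Fin 2) (Fin 2) ℂ →ₗ[ℂ] ℂ where
  toFun M := bif d then M 0 0 + M 0 1 else M 1 0 + M 1 1
  map_add' M N := by cases d <;> simp <;> ring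
  map_smul' c M := by cases d <;> simp <;> ring

theorem rowSum_one (d : Bool) : rowSum d 1 = 1 := by
  cases d <;> simp [rowSum]

theorem rowSum_evalPoint_diagLetter_mul (p : ℕ ⊕ ℕ × Bool → ℂ) (x : ℕ) (d : Bool)
    (M : Matrix (Fin 2) (Fin 2) ℂ) :
    rowSum d (evalPoint hn hω p (diagLetter n ω x) * M)
      = (bif d then p (.inl x) else -p (.inl x)) * rowSum d M := by
  rw [evalPoint_diagLetter]
  cases d <;> simp [rowSum, Matrix.mul_apply, mul_add, -Matrix.cons_mul]

theorem rowSum_evalPoint_offDiagLetter_mul (p : ℕ ⊕ ℕ × Bool → ℂ) (y : ℕ × Bool) (b d : Bool)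
    (M : Matrix (Fin 2) (Fin 2) ℂ) :
    rowSum d (evalPoint hn hω p (offDiagLetter n ω b y) * M)
      = if d = b then p (.inr y) * rowSum (!d) M else 0 := by
  rw [evalPoint_offDiagLetter]
  cases d <;> cases b <;> simp [rowSum, Matrix.mul_apply, mul_add, -Matrix.cons_mul]

variable (n ω) in
/-- The words in the letters of `ℂ⟨X; D_n⟩`. -/
noncomputable abbrev word (d : Bool) (l : List (ℕ ⊕ ℕ × Bool)) :
    FreeGAlgebra ℂ ℕ (DihedralGroup n) :=
  altWord (diagLetter n ω) (offDiagLetter n ω) d l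

/-- On the row of its first letter, a word takes as value the monomial spelled by its list. -/
theorem rowSum_evalPoint_word (p : ℕ ⊕ ℕ × Bool → ℂ) (d : Bool) (l : List (ℕ ⊕ ℕ × Bool)) :
    rowSum d (evalPoint hn hω p (word n ω d l)) = (l.map p).prod := by
  induction l generalizing d with
  | nil => simp [word, altWord, rowSum_one]
  | cons s l ih =>
    rcases s with x | y
    · cases d <;> simp [word, altWord, rowSum_evalPoint_diagLetter_mul, ih]
    · simp [word, altWord, rowSum_evalPoint_offDiagLetter_mul, ih]

/-- On the other row, a word with an off-diagonal letter vanishes. -/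
theorem rowSum_not_evalPoint_word_of_not_isLeft (p : ℕ ⊕ ℕ × Bool → ℂ) (d : Bool)
    {l : List (ℕ ⊕ ℕ × Bool)} (hl : ¬ ∀ s ∈ l, s.isLeft) :
    rowSum (!d) (evalPoint hn hω p (word n ω d l)) = 0 := by
  induction l with
  | nil => simp at hl
  | cons s l ih =>
    rcases s with x | y
    · have := ih (by simpa using hl)
      cases d <;> simp_all [word, altWord, rowSum_evalPoint_diagLetter_mul]
    · simp [word, altWord, rowSum_evalPoint_offDiagLetter_mul]

theorem rowSum_false_evalPoint_word_true_of_isLeft (p : ℕ ⊕ ℕ × Bool → ℂ)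
    {l : List (ℕ ⊕ ℕ × Bool)} (hl : ∀ s ∈ l, s.isLeft) :
    rowSum false (evalPoint hn hω p (word n ω true l)) = (-1) ^ l.length * (l.map p).prod := by
  rw [← rowSum_evalPoint_word hn hω p false l, word, word, altWord_false_of_forall_isLeft hl]
  rcases neg_one_pow_eq_or (FreeGAlgebra ℂ ℕ (DihedralGroup n)) l.length with e | e <;>
    rcases Nat.even_or_odd l.length with h | h <;> simp [h.neg_one_pow]

end Evaluation

/-! ### Recovering a polynomial from its values -/

section Recovery

open MvPolynomial

variable {n : ℕ} {ω : ℂ} {Q : Type*} [Ring Q] [Algebra ℂ Q]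
  (π : FreeGAlgebra ℂ ℕ (DihedralGroup n) →ₐ[ℂ] Q)

open Classical in
/-- The linear map that sends a pair of polynomials, the row sums of the values of a combination of
normal words, to the image of that combination under `π`. A monomial of the first row yields
the word of the first row that it spells, and likewise for the second row, except that monomials
without off-diagonal coordinates are disregarded there: in the values of normal words they only
repeat what the first row says. -/
noncomputable def recover :
    (Bool → MvPolynomial (ℕ ⊕ ℕ × Bool) ℂ) →ₗ[ℂ] Q :=
  (basisMonomials (ℕ ⊕ ℕ × Bool) ℂ).constr ℂ
      (fun s => π (word n ω true (Finsupp.toMultiset s).toList)) ∘ₗ LinearMap.proj true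
    + (basisMonomials (ℕ ⊕ ℕ × Bool) ℂ).constr ℂ
      (fun s => if ∀ i ∈ Finsupp.toMultiset s, i.isLeft then 0 else
        π (word n ω false (Finsupp.toMultiset s).toList)) ∘ₗ LinearMap.proj false

theorem prod_map_X_eq_basisMonomials {σ : Type*} (l : List σ) :
    ∃ s : σ →₀ ℕ, Finsupp.toMultiset s = (l : Multiset σ) ∧
      (l.map X).prod = basisMonomials σ ℂ s := by
  classical
  refine ⟨Multiset.toFinsupp (l : Multiset σ), by simp, ?_⟩
  rw [coe_basisMonomials]
  induction l with
  | nil => simp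
  | cons i l ih =>
    rw [List.map_cons, List.prod_cons, ih, ← Multiset.cons_coe, ← Multiset.singleton_add,
      map_add, Multiset.toFinsupp_singleton, X, monomial_mul, one_mul]

/-- The row sums of the values of a combination of normal words are polynomials in the matrix
entries that determine the image of the combination. -/
theorem exists_recover_eq (hn : 3 ≤ n) (hω : IsPrimitiveRoot ω n)
    (hπ : IsMatrixSystem (fun x => π (diagLetter n ω x)) (fun d y => π (offDiagLetter n ω d y)))
    {f : FreeGAlgebra ℂ ℕ (DihedralGroup n)}
    (hf : f ∈ Submodule.span ℂ (normalWords (diagLetter n ω) (offDiagLetter n ω))) :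
    ∃ q : Bool → MvPolynomial (ℕ ⊕ ℕ × Bool) ℂ,
      (∀ p d, MvPolynomial.eval p (q d) = rowSum d (evalPoint hn hω p f)) ∧
        recover (ω := ω) π q = π f := by
  induction hf using Submodule.span_induction with
  | mem f hf =>
    obtain ⟨d, l, hd, rfl⟩ := hf
    obtain ⟨s, hs, hsX⟩ := prod_map_X_eq_basisMonomials l
    have hperm : (Finsupp.toMultiset s).toList.Perm l := by
      rw [← Multiset.coe_eq_coe, Multiset.coe_toList, hs]
    have hw : ∀ d, π (word n ω d (Finsupp.toMultiset s).toList) = π (word n ω d l) := fun d => by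
      simp only [word, map_altWord]
      exact hπ.altWord_perm hperm d
    have heval : ∀ p : ℕ ⊕ ℕ × Bool → ℂ,
        MvPolynomial.eval p (basisMonomials _ ℂ s) = (l.map p).prod := fun p => by
      rw [← hsX, map_list_prod, List.map_map]
      congr 1
      exact List.map_congr_left fun i _ => by simp
    by_cases hl : ∀ i ∈ l, i.isLeft
    · obtain rfl : d = true := by
        by_contra h
        exact hd (by simpa using h) hl
      refine ⟨fun b => bif b then basisMonomials _ ℂ s else
        (-1 : ℂ) ^ l.length • basisMonomials _ ℂ s, ?_, ?_⟩
      · rintro p (_ | _)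
        · beta_reduce
          rw [cond_false, smul_eval, heval]
          exact (rowSum_false_evalPoint_word_true_of_isLeft hn hω p hl).symm
        · exact (heval p).trans (rowSum_evalPoint_word hn hω p true l).symm
      · have hl' : ∀ i ∈ Finsupp.toMultiset s, i.isLeft := by simpa [hs] using hl
        rw [recover, LinearMap.add_apply, LinearMap.comp_apply, LinearMap.comp_apply,
          LinearMap.proj_apply, LinearMap.proj_apply, cond_true, cond_false, map_smul,
          Module.Basis.constr_basis, Module.Basis.constr_basis, if_pos hl', smul_zero, add_zero, hw]
    · have hl' : ¬ ∀ i ∈ Finsupp.toMultiset s, i.isLeft := by simpa [hs] using hl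
      refine ⟨fun b => if b = d then basisMonomials _ ℂ s else 0, fun p b => ?_, ?_⟩
      · beta_reduce
        by_cases hb : b = d
        · rw [if_pos hb, heval, hb]
          exact (rowSum_evalPoint_word hn hω p d l).symm
        · rw [if_neg hb, map_zero, Bool.eq_not.2 hb]
          exact (rowSum_not_evalPoint_word_of_not_isLeft hn hω p d hl).symm
      · rw [recover, LinearMap.add_apply, LinearMap.comp_apply, LinearMap.comp_apply,
          LinearMap.proj_apply, LinearMap.proj_apply]
        cases d
        · rw [if_neg (by simp), if_pos rfl, map_zero, zero_add, Module.Basis.constr_basis,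
            if_neg hl', hw]
        · rw [if_pos rfl, if_neg (by simp), map_zero, add_zero, Module.Basis.constr_basis, hw]
  | zero => exact ⟨0, by simp, by simp⟩
  | add u v _ _ hu hv =>
    obtain ⟨q, hq, hq'⟩ := hu
    obtain ⟨r, hr, hr'⟩ := hv
    exact ⟨q + r, by simp [hq, hr], by simp [hq', hr']⟩
  | smul c u _ hu =>
    obtain ⟨q, hq, hq'⟩ := hu
    exact ⟨c • q, by simp [hq], by simp [hq']⟩

end Recovery

/-! ### The weak identities of the pair -/

section WeakIdentities

variable {n : ℕ} (hn : 3 ≤ n) {ω : ℂ} (hω : IsPrimitiveRoot ω n)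

theorem mem_sl_iff {M : Matrix (Fin 2) (Fin 2) ℂ} :
    M ∈ LieAlgebra.SpecialLinear.sl (Fin 2) ℂ ↔ M.trace = 0 := Iff.rfl

theorem exists_eq_of_mem_sl {M : Matrix (Fin 2) (Fin 2) ℂ}
    (hM : M ∈ LieAlgebra.SpecialLinear.sl (Fin 2) ℂ) : ∃ a b c, M = !![a, b; c, -a] := by
  rw [mem_sl_iff, Matrix.trace_fin_two, add_comm, add_eq_zero_iff_eq_neg] at hM
  exact ⟨M 0 0, M 0 1, M 1 0, by rw [← hM]; exact Matrix.eta_fin_two M⟩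

theorem isWeakGIdentity_of_mem_identities {f : FreeGAlgebra ℂ ℕ (DihedralGroup n)}
    (hf : f ∈ identities n ω) :
    IsWeakGIdentity (dihedralAction hn hω) (LieAlgebra.SpecialLinear.sl (Fin 2) ℂ) f := by
  intro a ha
  obtain ⟨a₁, b₁, c₁, h₁⟩ := exists_eq_of_mem_sl (ha 1)
  obtain ⟨a₂, b₂, c₂, h₂⟩ := exists_eq_of_mem_sl (ha 2)
  obtain ⟨a₃, b₃, c₃, h₃⟩ := exists_eq_of_mem_sl (ha 3)
  have hx : ∀ i, FreeGAlgebra.eval (dihedralAction hn hω) a (x n i) = a i := fun i => by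
    rw [x, eval_ι, map_one, AlgEquiv.one_apply]
  have hz : ∀ M : Matrix (Fin 2) (Fin 2) ℂ,
      M 0 0 = 0 → M 0 1 = 0 → M 1 0 = 0 → M 1 1 = 0 → M = 0 := fun M h h' h'' h''' => by
    ext i j
    fin_cases i <;> fin_cases j <;> assumption
  cases hf with
  | id1 =>
    apply hz <;> simp [eval_var, groupAlgebraAction_e, groupAlgebraAction_h, h₁]
  | id2 α hα f hf =>
    rcases hα with rfl | rfl <;> rcases hf with rfl | rfl <;> apply hz <;>
    simp [eval_var, groupAlgebraAction_e, groupAlgebraAction_h, h₁, h₂, mul_comm]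
  | id3 => simp [eval_var, groupAlgebraAction_e, hx, h₁]
  | id4 => simp [eval_var, groupAlgebraAction_e, h₁, h₂, mul_comm]
  | id5 α hα f hf =>
    rcases hα with rfl | rfl <;> rcases hf with rfl | rfl <;> apply hz <;>
    simp [eval_var, groupAlgebraAction_e, groupAlgebraAction_h, h₁, h₂]
  | id6 α hα f g hfg =>
    rcases hα with rfl | rfl <;> rcases hfg with ⟨rfl, rfl⟩ | ⟨rfl, rfl⟩ <;> apply hz <;>
    simp [eval_var, groupAlgebraAction_e, groupAlgebraAction_h, h₁, h₂]
  | id7 α hα f g hf hg =>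
    rcases hα with rfl | rfl <;> rcases hf with rfl | rfl <;> rcases hg with rfl | rfl <;>
    apply hz <;>
    simp [eval_var, groupAlgebraAction_e, groupAlgebraAction_h, hx, h₁, h₂, h₃] <;> ring
  | id8 α hα =>
    rcases hα with rfl | rfl <;> apply hz <;>
    simp [eval_var, groupAlgebraAction_e, groupAlgebraAction_h, hx, h₁, h₂, h₃] <;> ring
  | id9 α hα =>
    rcases hα with rfl | rfl <;>
    simp [eval_var, groupAlgebraAction_e, groupAlgebraAction_h, h₁, h₂, mul_comm]
  | id10 α hα =>
    rcases hα with rfl | rfl <;>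
    simp [eval_var, groupAlgebraAction_e, groupAlgebraAction_h, h₁, h₂, mul_comm]

/-- The heart of the argument: the image of a polynomial is that of a combination of normal words
with the same values, and if these all vanish then so do the row polynomials from which that image
is recovered. -/
theorem map_eq_zero_of_isWeakGIdentity {Q : Type*} [Ring Q] [Algebra ℂ Q]
    {π : FreeGAlgebra ℂ ℕ (DihedralGroup n) →ₐ[ℂ] Q}
    (hπ : ∀ p ∈ identities n ω, ∀ σ τ, π (subst σ τ p) = 0)
    (hker : ∀ f, π f = 0 → IsWeakGIdentity (dihedralAction hn hω)
      (LieAlgebra.SpecialLinear.sl (Fin 2) ℂ) f)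
    {f : FreeGAlgebra ℂ ℕ (DihedralGroup n)}
    (hf : IsWeakGIdentity (dihedralAction hn hω)
      (LieAlgebra.SpecialLinear.sl (Fin 2) ℂ) f) : π f = 0 := by
  have : NeZero n := ⟨by omega⟩
  have h0 : ω ≠ 0 := hω.ne_zero (by omega)
  have hrange : normalWords (fun x => π (diagLetter n ω x)) (fun d y => π (offDiagLetter n ω d y))
      = π.toLinearMap '' normalWords (diagLetter n ω) (offDiagLetter n ω) := by
    ext w
    constructor
    · rintro ⟨d, l, hd, rfl⟩
      exact ⟨_, ⟨d, l, hd, rfl⟩, map_altWord _ _ π d l⟩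
    · rintro ⟨_, ⟨d, l, hd, rfl⟩, rfl⟩
      exact ⟨d, l, hd, map_altWord _ _ π d l⟩
  have hmem := map_mem_span_normalWords hω h0 hπ f
  rw [hrange, ← Submodule.map_span] at hmem
  obtain ⟨v, hv, hvf⟩ := hmem
  replace hvf : π v = π f := hvf
  obtain ⟨q, hq, hqv⟩ := exists_recover_eq π hn hω (isMatrixSystem_letters hω h0 hπ) hv
  have hev : ∀ p, evalPoint hn hω p v = 0 := fun p => by
    have hp : ∀ x, pointMatrix p x ∈ LieAlgebra.SpecialLinear.sl (Fin 2) ℂ := fun x => by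
      simp [mem_sl_iff, pointMatrix, Matrix.trace_fin_two]
    have h1 := hker (v - f) (by rw [map_sub, hvf, sub_self]) (pointMatrix p) hp
    rwa [map_sub, hf _ hp, sub_zero] at h1
  have hq0 : q = 0 := by
    ext1 d
    exact MvPolynomial.funext fun p => by rw [hq, hev]; simp
  rw [← hvf, ← hqv, hq0, map_zero]

end WeakIdentities

end DihedralIdentities

theorem mainTheorem3 (n : ℕ) (hn : 3 ≤ n) (ω : ℂ) (hω : IsPrimitiveRoot ω n) :
    FreeGAlgebra.IsBasisOfWeakGIdentities (dihedralAction hn hω)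
      (LieAlgebra.SpecialLinear.sl (Fin 2) ℂ) (DihedralIdentities.identities n ω) := by
  have hideal := FreeGAlgebra.isWeakGIdeal_weakGIdentities (X := ℕ) (dihedralAction hn hω)
    (LieAlgebra.SpecialLinear.sl (Fin 2) ℂ)
    fun k y hy => by
      rw [DihedralIdentities.mem_sl_iff] at hy ⊢
      rw [DihedralIdentities.trace_dihedralAction, hy]
  have hsub : DihedralIdentities.identities n ω ⊆ FreeGAlgebra.weakGIdentities ℕ
      (dihedralAction hn hω) (LieAlgebra.SpecialLinear.sl (Fin 2) ℂ) := fun f hf =>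
    FreeGAlgebra.mem_weakGIdentities.2
      (DihedralIdentities.isWeakGIdentity_of_mem_identities hn hω hf)
  refine ⟨⟨hideal, hsub⟩, ?_⟩
  rintro I ⟨hI, hSI⟩ f hf
  -- `I` may contain polynomials that are not identities. Intersecting it with the ideal of all weak
  -- identities keeps it a weak ideal containing the ten, and evaluations descend to the quotient.
  set J := I ⊓ FreeGAlgebra.weakGIdentities ℕ (dihedralAction hn hω)
    (LieAlgebra.SpecialLinear.sl (Fin 2) ℂ)
  have hmk : ∀ g, RingCon.mkₐ ℂ J.ringCon g = 0 ↔ g ∈ J := fun g => by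
    rw [TwoSidedIdeal.mem_iff, ← RingCon.eq]
    rfl
  have hfJ : f ∈ J := (hmk f).1 <|
    DihedralIdentities.map_eq_zero_of_isWeakGIdentity hn hω
      (fun p hp σ τ => (hmk _).2 ((TwoSidedIdeal.mem_inf _).2
        ⟨hI _ (FreeGAlgebra.isPairEndomorphism_subst σ τ) _ (hSI hp),
          hideal _ (FreeGAlgebra.isPairEndomorphism_subst σ τ) _ (hsub hp)⟩))
      (fun g hg => FreeGAlgebra.mem_weakGIdentities.1 ((TwoSidedIdeal.mem_inf _).1 ((hmk g).1 hg)).2)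
      (FreeGAlgebra.mem_weakGIdentities.1 hf)
  exact ((TwoSidedIdeal.mem_inf _).1 hfJ).1
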